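/- Let $\{\varphi_n\}_{n\in I}$ ($I=\mathbb N$ or $I=\mathbb Z$ or, more generally, any non-empty index set) be an orthonormal system of complex-valued functions in $L_2[0,1]$ with $\sup_{n}\|\varphi_n\|_{L_\infty}=M<\infty$. For $f\in L_1[0,1]$ put $c_n(f)=\int_0^1 f(x)\overline{\varphi_n(x)}\,dx$ and $\mathcal F(f)=\{c_n(f)\}_{n\in I}$. Denote by $f^*$ the non-increasing rearrangement of $|f|$ on $[0,1]$, i.e. $f^*(u)=\inf\{s\ge 0: |\{x\in[0,1]:|f(x)|>s\}|\le u\}$, and by $c_1^*\ge c_2^*\ge\dots$ the non-increasing rearrangement of a family $\{|c_n|\}_{n\in I}$, i.e. $c_k^*=\inf\{s\ge 0:\#\{n\in I:|c_n|>s\}\le k-1\}$. For $0<q\le\infty$ and $\alpha\in\mathbb R$ let $$\|f\|_{L^{\mathcal R}_{2,q,\alpha,2}}=\left(\int_0^1\left[(1+|\log t|)^\alpha\left(\int_t^1 f^*(u)^2\,du\right)^{1/2}\right]^q\frac{dt}{t}\right)^{1/q},$$ $$\|c\|_{l^{\mathcal L}_{2,q,\alpha,2}}=\left(\sum_{k=1}^\infty\left[(1+\log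 k)^\alpha\left(\sum_{i=1}^k (c_i^*)^2\right)^{1/2}\right]^q\frac1k\right)^{1/q},$$ with the integral over $t$ and the sum over $k$ replaced by suprema when $q=\infty$, and let $L^{\mathcal R}_{2,q,\alpha,2}$ be the set of all measurable $f:[0,1]\to\mathbb C$ with $\|f\|_{L^{\mathcal R}_{2,q,\alpha,2}}<\infty$. **Theorem.** Let $0<q\le\infty$ and $\alpha<-1/q$ (with $1/\infty=0$). There is a constant $C>0$, depending only on $q$ and $\alpha$, such that for every such system $\{\varphi_n\}$, with its $M$, every $f\in L^{\mathcal R}_{2,q,\alpha,2}$ is integrable (so that $\mathcal F(f)$ is defined) and $$\|\mathcal F(f)\|_{l^{\mathcal L}_{2,q,\alpha,2}}\le C\,\min\bigl(M,(1+\log M)^{|\alpha|}\bigr)\,\|f\|_{L^{\mathcal R}_{2,q,\alpha,2}}.$$ -/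

import Mathlib

open MeasureTheory
open scoped ENNReal NNReal ComplexConjugate

noncomputable section

namespace LimitingFourier

/-- Lebesgue measure on `[0, 1]`. -/
abbrev μ01 : Measure ℝ := volume.restrict (Set.Icc (0 : ℝ) 1)

/-- The non-increasing rearrangement `f*` of `|f|` on `[0, 1]`:
`f*(u) = inf {s ≥ 0 : |{x ∈ [0, 1] : |f x| > s}| ≤ u}`. -/
def rearr (f : ℝ → ℂ) (u : ℝ) : ℝ≥0∞ :=
  sInf {s : ℝ≥0∞ | μ01 {x | s < ‖f x‖ₑ} ≤ ENNReal.ofReal u}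

/-- The non-increasing rearrangement of a family `|c|`, numbered from `0`:
`seqRearr c k` is `c*_{k+1} = inf {s ≥ 0 : #{n : |c n| > s} ≤ k}`. -/
def seqRearr {ι : Type} (c : ι → ℂ) (k : ℕ) : ℝ≥0∞ :=
  sInf {s : ℝ≥0∞ | Set.encard {n | s < ‖c n‖ₑ} ≤ (k : ℕ∞)}

/-- The quasi-norm of `L^R_{2,q,α,2}`: the `L_q(0,1)`-quasi-norm of
`t^{-1/q} (1 + |log t|)^α (∫_t^1 f*(u)² du)^{1/2}`. -/
def normLR (q : ℝ≥0∞) (α : ℝ) (f : ℝ → ℂ) : ℝ≥0∞ :=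
  eLpNorm
    (fun t : ℝ =>
      ENNReal.ofReal (t ^ (-(q⁻¹).toReal) * (1 + |Real.log t|) ^ α) *
        (∫⁻ u in Set.Ioo t 1, rearr f u ^ 2) ^ (1 / 2 : ℝ))
    q (volume.restrict (Set.Ioo (0 : ℝ) 1))

/-- The quasi-norm of `l^L_{2,q,α,2}`: the `l_q`-quasi-norm over `k = 1, 2, …` of
`k^{-1/q} (1 + log k)^α (∑_{i ≤ k} (c*_i)²)^{1/2}`; here `k` is shifted by one. -/
def normlL {ι : Type} (q : ℝ≥0∞) (α : ℝ) (c : ι → ℂ) : ℝ≥0∞ :=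
  eLpNorm
    (fun k : ℕ =>
      ENNReal.ofReal
          (((k : ℝ) + 1) ^ (-(q⁻¹).toReal) * (1 + Real.log ((k : ℝ) + 1)) ^ α) *
        (∑ i ∈ Finset.range (k + 1), seqRearr c i ^ 2) ^ (1 / 2 : ℝ))
    q Measure.count

/-- Membership in `L^R_{2,q,α,2}`. -/
def MemLR (q : ℝ≥0∞) (α : ℝ) (f : ℝ → ℂ) : Prop :=
  AEStronglyMeasurable f μ01 ∧ normLR q α f < ∞

/-- The Fourier coefficients `c_n(f) = ∫_0^1 f(x) conj(φ_n(x)) dx`. -/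
def fourierCoeffs {ι : Type} (φ : ι → Lp ℂ 2 μ01) (f : ℝ → ℂ) (n : ι) : ℂ :=
  ∫ x, f x * conj (φ n x) ∂μ01

end LimitingFourier

end

namespace LimitingFourier

/-! ### Comparison of the weighted sums with the weighted integral -/

/-! Cut `f` at the height `f*(s)`. By Bessel's inequality the squared coefficients of the low part
sum to at most `s⁻¹ (∫_0^s f*)² + ∫_s^1 (f*)²`, while each coefficient of the high part is at most
`M ∫_0^s f*`. So the `k` largest squared coefficients of `f` are controlled by these two terms and
`k M² (∫_0^s f*)²`. The choice `s = 1/(M² k)` makes the two head terms coincide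
(`partialSum_fourierCoeffs_le`).

Cauchy–Schwarz on dyadic cells bounds `s^(-1/2) ∫_0^s f*` by a constant times `sup_j 2^(-j/4) tail f
(s/2^j)` (`head_le_dyadicSup`). What remains is the weighted `l_q` quasi-norm of `k ↦ tail f (a/k)`
with `a = 1/(M² 2^j)`. The tail is non-increasing and `dt/t` is scale invariant, so comparison with
the integral costs only `(1 + log(2/a))^|α|` (`eLpNorm_seqWeight_le`). The part of this factor that
grows with `j` is absorbed by `2^(-j/4)`; the rest is `(1 + log M)^|α|`, which is itself `O(M)`,
whence the minimum. -/

theorem weight_le {e α a K t : ℝ} (he : 0 ≤ e) (hα : α ≤ 0) (ha : 0 < a) (ha1 : a ≤ 1)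
    (hK : 1 ≤ K) (ht : a / (K + 1) < t) (ht' : t < a / K) :
    K ^ (-e) * (1 + Real.log K) ^ α ≤
      (2 ^ e * (1 + Real.log (2 / a)) ^ (-α)) * (a / K - a / (K + 1)) ^ e *
        (t ^ (-e) * (1 + |Real.log t|) ^ α) := by
  have hK0 : 0 < K := by linarith
  have ht0 : 0 < t := lt_trans (by positivity) ht
  have haK : a / K ≤ 1 := by rw [div_le_one hK0]; linarith
  have hlogK : 0 ≤ Real.log K := Real.log_nonneg hK
  have hloga : 0 ≤ Real.log (2 / a) := Real.log_nonneg (by rw [le_div_iff₀ ha]; linarith)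
  have hlogt : |Real.log t| ≤ Real.log K + Real.log (2 / a) := by
    rw [abs_of_nonpos (Real.log_nonpos ht0.le (by linarith)), ← Real.log_inv,
      ← Real.log_mul hK0.ne' (by positivity)]
    apply Real.log_le_log (by positivity)
    rw [inv_le_comm₀ ht0 (by positivity)]
    refine le_trans ?_ ht.le
    rw [mul_div_assoc', inv_div]
    exact div_le_div_of_nonneg_left ha.le (by linarith) (by linarith)
  -- Since `1 + x + y ≤ (1 + x)(1 + y)`, the shift of the logarithm by `log (2/a)` becomes a
  -- multiplicative constant.
  have h1 : (1 + Real.log K) ^ α ≤ (1 + Real.log (2 / a)) ^ (-α) * (1 + |Real.log t|) ^ α := by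
    have h2 : ((1 + Real.log K) * (1 + Real.log (2 / a))) ^ α ≤ (1 + |Real.log t|) ^ α :=
      Real.rpow_le_rpow_of_nonpos (by positivity) (by nlinarith) hα
    rw [Real.mul_rpow (by positivity) (by positivity)] at h2
    rw [Real.rpow_neg (by positivity), ← div_eq_inv_mul, le_div_iff₀ (by positivity)]
    exact h2
  have hd : 0 ≤ a / K - a / (K + 1) := by
    rw [sub_nonneg]; exact div_le_div_of_nonneg_left ha.le hK0 (by linarith)
  have h3 : K ^ (-e) ≤ 2 ^ e * (a / K - a / (K + 1)) ^ e * t ^ (-e) := by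
    rw [Real.rpow_neg hK0.le, Real.rpow_neg ht0.le, ← Real.inv_rpow hK0.le, ← Real.inv_rpow ht0.le,
      ← Real.mul_rpow (by norm_num) hd, ← Real.mul_rpow (by positivity) (by positivity)]
    apply Real.rpow_le_rpow (by positivity) _ he
    rw [← div_eq_mul_inv, le_div_iff₀ ht0]
    calc K⁻¹ * t ≤ K⁻¹ * (a / K) := by gcongr
      _ ≤ 2 * (a / K - a / (K + 1)) := by
        have : 2 * (a / K - a / (K + 1)) - K⁻¹ * (a / K) = a * (K - 1) / (K ^ 2 * (K + 1)) := by
          field_simp; ring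
        have h4 : 0 ≤ a * (K - 1) / (K ^ 2 * (K + 1)) :=
          div_nonneg (mul_nonneg ha.le (by linarith)) (by positivity)
        linarith
  calc K ^ (-e) * (1 + Real.log K) ^ α
      ≤ (2 ^ e * (a / K - a / (K + 1)) ^ e * t ^ (-e)) *
        ((1 + Real.log (2 / a)) ^ (-α) * (1 + |Real.log t|) ^ α) :=
        mul_le_mul h3 h1 (by positivity) (by positivity)
    _ = _ := by ring

/-- The weight of the function quasi-norm. -/
noncomputable def weight (q : ℝ≥0∞) (α t : ℝ) : ℝ≥0∞ :=
  ENNReal.ofReal (t ^ (-(q⁻¹).toReal) * (1 + |Real.log t|) ^ α)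

/-- The weight of the sequence quasi-norm. -/
noncomputable def seqWeight (q : ℝ≥0∞) (α : ℝ) (k : ℕ) : ℝ≥0∞ :=
  ENNReal.ofReal (((k : ℝ) + 1) ^ (-(q⁻¹).toReal) * (1 + Real.log ((k : ℝ) + 1)) ^ α)

/-- The power `1/q` of the cell length is kept explicit so that it cancels after raising to the
power `q` and integrating over the cell. -/
theorem seqWeight_mul_le {q : ℝ≥0∞} {α a t : ℝ} {F : ℝ → ℝ≥0∞} (hF : Antitone F) (hα : α ≤ 0)
    (ha : 0 < a) (ha1 : a ≤ 1) (k : ℕ)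
    (ht : t ∈ Set.Ioo (a / ((k : ℝ) + 1 + 1)) (a / ((k : ℝ) + 1))) :
    seqWeight q α k * F (a / ((k : ℝ) + 1)) ≤
      ENNReal.ofReal (2 ^ (q⁻¹).toReal * (1 + Real.log (2 / a)) ^ (-α)) *
        ENNReal.ofReal (a / ((k : ℝ) + 1) - a / ((k : ℝ) + 1 + 1)) ^ (q⁻¹).toReal *
          (weight q α t * F t) := by
  have hk : (1 : ℝ) ≤ (k : ℝ) + 1 := by linarith [k.cast_nonneg (α := ℝ)]
  have hd : 0 ≤ a / ((k : ℝ) + 1) - a / ((k : ℝ) + 1 + 1) := by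
    rw [sub_nonneg]; exact div_le_div_of_nonneg_left ha.le (by linarith) (by linarith)
  have hL : 0 ≤ Real.log (2 / a) := Real.log_nonneg (by rw [le_div_iff₀ ha]; linarith)
  have ht0 : 0 < t := lt_trans (by positivity) ht.1
  rw [← mul_assoc, seqWeight, weight, ENNReal.ofReal_rpow_of_nonneg hd ENNReal.toReal_nonneg,
    ← ENNReal.ofReal_mul (by positivity), ← ENNReal.ofReal_mul (by positivity)]
  exact mul_le_mul' (ENNReal.ofReal_le_ofReal
    (weight_le ENNReal.toReal_nonneg hα ha ha1 hk ht.1 ht.2)) (hF ht.2.le)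

theorem eLpNorm_seqWeight_le {q : ℝ≥0∞} (hq : 0 < q) {α a : ℝ} {F : ℝ → ℝ≥0∞} (hF : Antitone F)
    (hα : α ≤ 0) (ha : 0 < a) (ha1 : a ≤ 1) :
    eLpNorm (fun k : ℕ => seqWeight q α k * F (a / ((k : ℝ) + 1))) q Measure.count ≤
      ENNReal.ofReal (2 ^ (q⁻¹).toReal * (1 + Real.log (2 / a)) ^ (-α)) *
        eLpNorm (fun t => weight q α t * F t) q (volume.restrict (Set.Ioo (0 : ℝ) 1)) := by
  set D := ENNReal.ofReal (2 ^ (q⁻¹).toReal * (1 + Real.log (2 / a)) ^ (-α)) with hD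
  have hdpos : ∀ k : ℕ, 0 < a / ((k : ℝ) + 1) - a / ((k : ℝ) + 1 + 1) := fun k => by
    rw [sub_pos]; exact div_lt_div_of_pos_left ha (by positivity) (by linarith)
  have hsub : ∀ k : ℕ, Set.Ioo (a / ((k : ℝ) + 1 + 1)) (a / ((k : ℝ) + 1)) ⊆ Set.Ioo 0 1 := by
    intro k t ht
    refine ⟨lt_trans (by positivity) ht.1, ht.2.trans_le ?_⟩
    rw [div_le_one (by positivity)]
    linarith [k.cast_nonneg (α := ℝ)]
  have hkey := fun (k : ℕ) (t : ℝ) => seqWeight_mul_le (q := q) (t := t) hF hα ha ha1 k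
  rcases eq_or_ne q ∞ with rfl | hqt
  · rw [eLpNorm_exponent_top, eLpNorm_exponent_top]
    refine eLpNormEssSup_le_of_ae_enorm_bound (Filter.Eventually.of_forall fun k => ?_)
    simp only [enorm_eq_self]
    have hae : ∀ᵐ t ∂(volume.restrict (Set.Ioo (a / ((k : ℝ) + 1 + 1)) (a / ((k : ℝ) + 1)))),
        weight ∞ α t * F t ≤
          eLpNormEssSup (fun t => weight ∞ α t * F t) (volume.restrict (Set.Ioo (0 : ℝ) 1)) := by
      exact ae_mono (Measure.restrict_mono (hsub k) le_rfl) <|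
        enorm_ae_le_eLpNormEssSup (fun t => weight ∞ α t * F t)
        (volume.restrict (Set.Ioo (0 : ℝ) 1))
    -- The cell has positive measure, so some point of it satisfies the almost everywhere bound.
    have : Filter.NeBot (ae (volume.restrict (Set.Ioo (a / ((k : ℝ) + 1 + 1)) (a / ((k : ℝ) + 1))))) := by
      rw [ae_neBot, Ne, Measure.restrict_eq_zero, Real.volume_Ioo]
      simpa using hdpos k
    obtain ⟨t, h1, h2⟩ := (hae.and (ae_restrict_mem measurableSet_Ioo)).exists
    refine (hkey k t h2).trans ?_
    simp only [ENNReal.inv_top, ENNReal.toReal_zero, ENNReal.rpow_zero, mul_one] at hD ⊢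
    rw [hD]
    gcongr
  · set p := q.toReal with hp
    have hp0 : 0 < p := ENNReal.toReal_pos hq.ne' hqt
    have hqp : (q⁻¹).toReal = p⁻¹ := ENNReal.toReal_inv q
    rw [eLpNorm_eq_lintegral_rpow_enorm_toReal hq.ne' hqt,
      eLpNorm_eq_lintegral_rpow_enorm_toReal hq.ne' hqt]
    simp only [enorm_eq_self, lintegral_count]
    rw [← hp]
    have hDp : D = (D ^ p) ^ (1 / p) := by
      rw [← ENNReal.rpow_mul, mul_one_div_cancel hp0.ne', ENNReal.rpow_one]
    rw [hDp, ← ENNReal.mul_rpow_of_nonneg _ _ (by positivity)]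
    apply ENNReal.rpow_le_rpow _ (by positivity)
    have hterm : ∀ k : ℕ, (seqWeight q α k * F (a / ((k : ℝ) + 1))) ^ p ≤
        D ^ p * ∫⁻ t in Set.Ioo (a / ((k : ℝ) + 1 + 1)) (a / ((k : ℝ) + 1)),
          (weight q α t * F t) ^ p := by
      intro k
      set d := ENNReal.ofReal (a / ((k : ℝ) + 1) - a / ((k : ℝ) + 1 + 1)) with hd
      have hd0 : d ≠ 0 := by simpa [hd] using hdpos k
      have hdt : d ≠ ∞ := ENNReal.ofReal_ne_top
      have hDt : D ^ p ≠ ∞ := ENNReal.rpow_ne_top_of_nonneg hp0.le ENNReal.ofReal_ne_top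
      have hpt : ∀ t ∈ Set.Ioo (a / ((k : ℝ) + 1 + 1)) (a / ((k : ℝ) + 1)),
          (seqWeight q α k * F (a / ((k : ℝ) + 1))) ^ p ≤ D ^ p * d * (weight q α t * F t) ^ p := by
        intro t ht
        refine (ENNReal.rpow_le_rpow (hkey k t ht) hp0.le).trans ?_
        rw [ENNReal.mul_rpow_of_nonneg _ _ hp0.le, ENNReal.mul_rpow_of_nonneg _ _ hp0.le,
          ← ENNReal.rpow_mul,
          show (q⁻¹).toReal * p = 1 by rw [hqp, inv_mul_cancel₀ hp0.ne'], ENNReal.rpow_one]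
      -- Integrating the constant left side produces the cell length `d`, which cancels the `d` on
      -- the right.
      have hint := setLIntegral_mono' (μ := volume) measurableSet_Ioo hpt
      rw [setLIntegral_const, Real.volume_Ioo, ← hd,
        lintegral_const_mul' _ _ (ENNReal.mul_ne_top hDt hdt), mul_right_comm] at hint
      exact (ENNReal.mul_le_mul_iff_left hd0 hdt).1 hint
    calc ∑' k : ℕ, (seqWeight q α k * F (a / ((k : ℝ) + 1))) ^ p
        ≤ ∑' k : ℕ, D ^ p * ∫⁻ t in Set.Ioo (a / ((k : ℝ) + 1 + 1)) (a / ((k : ℝ) + 1)),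
          (weight q α t * F t) ^ p := ENNReal.tsum_le_tsum hterm
      _ = D ^ p * ∫⁻ t in ⋃ k : ℕ, Set.Ioo (a / ((k : ℝ) + 1 + 1)) (a / ((k : ℝ) + 1)),
          (weight q α t * F t) ^ p := by
        rw [ENNReal.tsum_mul_left, lintegral_iUnion (fun _ => measurableSet_Ioo)]
        have hanti : Antitone (fun k : ℕ => a / ((k : ℝ) + 1)) := fun m n hmn => by
          dsimp only
          gcongr
        have := hanti.pairwise_disjoint_on_Ioo_succ
        simpa [Order.succ_eq_add_one] using this
      _ ≤ _ := by
        gcongr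
        exact Set.iUnion_subset hsub

/-! ### Suprema of geometrically decaying families -/

/-- For finite `q`, the bound `(sup g_j)^q ≤ ∑ g_j^q` leaves a geometric series of ratio `r^q`. No
triangle inequality enters, so `q < 1` needs no separate treatment. -/
theorem eLpNorm_iSup_le_of_geometric {X : Type*} [MeasurableSpace X] {μ : Measure X} {q r : ℝ≥0∞}
    (hq : 0 < q) (hr : r < 1) : ∃ C : ℝ≥0, ∀ (g : ℕ → X → ℝ≥0∞) (B : ℝ≥0∞),
      (∀ j, Measurable (g j)) → (∀ j, eLpNorm (g j) q μ ≤ r ^ j * B) →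
        eLpNorm (fun x => ⨆ j, g j x) q μ ≤ C * B := by
  rcases eq_or_ne q ∞ with rfl | hqt
  · refine ⟨1, fun g B _ h => ?_⟩
    simp only [eLpNorm_exponent_top] at h ⊢
    refine eLpNormEssSup_le_of_ae_enorm_bound ?_
    have : ∀ᵐ x ∂μ, ∀ j, ‖g j x‖ₑ ≤ eLpNormEssSup (g j) μ :=
      ae_all_iff.2 fun j => enorm_ae_le_eLpNormEssSup _ _
    filter_upwards [this] with x hx
    simp only [enorm_eq_self] at hx ⊢
    rw [ENNReal.coe_one, one_mul]
    refine iSup_le fun j => (hx j).trans ((h j).trans ?_)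
    calc r ^ j * B ≤ 1 * B := by gcongr; exact pow_le_one₀ zero_le hr.le
      _ = B := one_mul B
  · set p := q.toReal with hp
    have hp0 : 0 < p := ENNReal.toReal_pos hq.ne' hqt
    have hrp : r ^ p < 1 := ENNReal.rpow_lt_one hr hp0
    have hfin : ((1 - r ^ p)⁻¹) ^ (1 / p) ≠ ∞ :=
      ENNReal.rpow_ne_top_of_nonneg (by positivity) 
      (ENNReal.inv_ne_top.2 (tsub_pos_of_lt hrp).ne')
    refine ⟨(((1 - r ^ p)⁻¹) ^ (1 / p)).toNNReal, fun g B hg h => ?_⟩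
    rw [ENNReal.coe_toNNReal hfin]
    simp only [eLpNorm_eq_lintegral_rpow_enorm_toReal hq.ne' hqt, enorm_eq_self, ← hp] at h ⊢
    have hBp : B = (B ^ p) ^ (1 / p) := by
      rw [← ENNReal.rpow_mul, mul_one_div_cancel hp0.ne', ENNReal.rpow_one]
    rw [hBp, ← ENNReal.mul_rpow_of_nonneg _ _ (by positivity)]
    apply ENNReal.rpow_le_rpow _ (by positivity)
    calc ∫⁻ x, (⨆ j, g j x) ^ p ∂μ ≤ ∫⁻ x, ∑' j, g j x ^ p ∂μ := by
          refine lintegral_mono fun x => ?_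
          rw [← ENNReal.le_rpow_inv_iff hp0]
          refine iSup_le fun j => ?_
          rw [ENNReal.le_rpow_inv_iff hp0]
          exact ENNReal.le_tsum j
      _ = ∑' j, ∫⁻ x, g j x ^ p ∂μ :=
          lintegral_tsum fun j => ((hg j).pow_const p).aemeasurable
      _ ≤ ∑' j, (r ^ p) ^ j * B ^ p := by
          refine ENNReal.tsum_le_tsum fun j => ?_
          have := ENNReal.rpow_le_rpow (h j) hp0.le
          rw [← ENNReal.rpow_mul, one_div_mul_cancel hp0.ne', ENNReal.rpow_one,
            ENNReal.mul_rpow_of_nonneg _ _ hp0.le, ← ENNReal.rpow_natCast, ← ENNReal.rpow_mul,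
            mul_comm (j : ℝ), ENNReal.rpow_mul, ENNReal.rpow_natCast] at this
          exact this
      _ = (1 - r ^ p)⁻¹ * B ^ p := by rw [ENNReal.tsum_mul_right, ENNReal.tsum_geometric]

/-! ### Elementary bounds for the constants -/

theorem exists_log_rpow_mul_pow_le {β r : ℝ} (hβ : 0 ≤ β) (hr0 : 0 < r) (hr : r < 1) :
    ∃ C : ℝ, 0 < C ∧ ∀ (j : ℕ) (M : ℝ), 1 ≤ M →
      (1 + Real.log (2 / (1 / M ^ 2 / 2 ^ j))) ^ β * r ^ j ≤ C * (1 + Real.log M) ^ β := by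
  obtain ⟨m, hm⟩ := exists_nat_ge β
  have ht := tendsto_pow_const_mul_const_pow_of_abs_lt_one m (r := r)
    (by rwa [abs_of_pos hr0])
  obtain ⟨b, hb⟩ := ht.bddAbove_range
  -- This is the bound for `n^m r^n` at `n = j + 2`; the shift costs `r⁻²`.
  have hbj : ∀ j : ℕ, ((j : ℝ) + 2) ^ β * r ^ j ≤ b / r ^ 2 := by
    intro j
    have h1 : ((j + 2 : ℕ) : ℝ) ^ m * r ^ (j + 2) ≤ b := hb ⟨j + 2, rfl⟩
    push_cast at h1
    rw [le_div_iff₀ (by positivity), mul_assoc, ← pow_add]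
    refine le_trans ?_ h1
    gcongr
    rw [← Real.rpow_natCast]
    exact Real.rpow_le_rpow_of_exponent_le (by linarith [j.cast_nonneg (α := ℝ)]) hm
  have hb0 : 0 < b / r ^ 2 := lt_of_lt_of_le (by positivity) (hbj 0)
  refine ⟨2 ^ β * (b / r ^ 2), by positivity, fun j M hM => ?_⟩
  have hM0 : 0 < M := by linarith
  have hlM : 0 ≤ Real.log M := Real.log_nonneg hM
  have hlog : Real.log (2 / (1 / M ^ 2 / 2 ^ j)) = (j + 1) * Real.log 2 + 2 * Real.log M := by
    have : 2 / (1 / M ^ 2 / 2 ^ j) = 2 ^ (j + 1) * M ^ 2 := by field_simp; ring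
    rw [this, Real.log_mul (by positivity) (by positivity), Real.log_pow, Real.log_pow]
    push_cast; ring
  have hl2 : Real.log 2 ≤ 1 := by linarith [Real.log_two_lt_d9]
  have hl20 : 0 ≤ Real.log 2 := Real.log_nonneg (by norm_num)
  have hj : (0 : ℝ) ≤ j := j.cast_nonneg
  rw [hlog]
  calc (1 + ((j + 1) * Real.log 2 + 2 * Real.log M)) ^ β * r ^ j
      ≤ (2 * ((j : ℝ) + 2) * (1 + Real.log M)) ^ β * r ^ j := by
        gcongr
        nlinarith [mul_nonneg hj hlM]
    _ = 2 ^ β * (((j : ℝ) + 2) ^ β * r ^ j) * (1 + Real.log M) ^ β := by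
        rw [Real.mul_rpow (by positivity) (by positivity),
          Real.mul_rpow (by positivity) (by positivity)]
        ring
    _ ≤ 2 ^ β * (b / r ^ 2) * (1 + Real.log M) ^ β := by
        gcongr
        exact hbj j

theorem one_add_log_rpow_le {β M : ℝ} (hβ : 0 < β) (hM : 1 ≤ M) :
    (1 + Real.log M) ^ β ≤ (1 + β) ^ β * M := by
  have hM0 : 0 ≤ M := by linarith
  have hlM : 0 ≤ Real.log M := Real.log_nonneg hM
  have h1 : Real.log M ≤ M ^ (1 / β) / (1 / β) := Real.log_le_rpow_div hM0 (by positivity)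
  have h2 : 1 ≤ M ^ (1 / β) := Real.one_le_rpow hM (by positivity)
  have h3 : 1 + Real.log M ≤ (1 + β) * M ^ (1 / β) := by
    rw [div_div_eq_mul_div, div_one] at h1
    linarith
  calc (1 + Real.log M) ^ β ≤ ((1 + β) * M ^ (1 / β)) ^ β := by gcongr
    _ = (1 + β) ^ β * M := by
      rw [Real.mul_rpow (by positivity) (by positivity), ← Real.rpow_mul hM0,
        one_div_mul_cancel hβ.ne', Real.rpow_one]

theorem one_add_log_rpow_le_mul_min {β M : ℝ} (hβ : 0 < β) (hM : 1 ≤ M) :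
    (1 + Real.log M) ^ β ≤ (1 + β) ^ β * min M ((1 + Real.log M) ^ β) := by
  have hlM : 0 ≤ Real.log M := Real.log_nonneg hM
  rw [mul_min_of_nonneg _ _ (by positivity)]
  refine le_min (one_add_log_rpow_le hβ hM) (le_mul_of_one_le_left (by positivity) ?_)
  exact Real.one_le_rpow (by linarith) hβ.le

/-! ### The non-increasing rearrangement of a function -/

instance isProbabilityMeasure_μ01 : IsProbabilityMeasure μ01 :=
  ⟨by simp [μ01]⟩

instance isProbabilityMeasure_restrict_Ioo :
    IsProbabilityMeasure (volume.restrict (Set.Ioo (0 : ℝ) 1)) :=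
  ⟨by simp⟩

/-- The infimum is attained: as `v n` decreases to `σ`, the sets `{|f| > v n}` increase to `{|f| >
σ}`. -/
theorem rearr_le_iff {f : ℝ → ℂ} {u : ℝ} {σ : ℝ≥0∞} :
    rearr f u ≤ σ ↔ μ01 {x | σ < ‖f x‖ₑ} ≤ ENNReal.ofReal u := by
  refine ⟨fun h => ?_, fun h => sInf_le h⟩
  rcases eq_or_ne σ ∞ with rfl | hσ
  · simp
  obtain ⟨v, hv, hvσ, hvt⟩ := exists_seq_strictAnti_tendsto' (show σ < ∞ from hσ.lt_top)
  have hU : {x | σ < ‖f x‖ₑ} = ⋃ n, {x | v n < ‖f x‖ₑ} := by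
    ext x
    simp only [Set.mem_ofPred_eq, Set.mem_iUnion]
    refine ⟨fun hx => (hvt.eventually_lt_const hx).exists, fun ⟨n, hn⟩ => (hvσ n).1.trans hn⟩
  have hmono : Monotone fun n => {x | v n < ‖f x‖ₑ} := fun m n hmn x hx =>
    (hv.antitone hmn).trans_lt hx
  rw [hU, hmono.measure_iUnion]
  refine iSup_le fun n => ?_
  obtain ⟨s, hs, hsv⟩ := sInf_lt_iff.1 (h.trans_lt (hvσ n).1)
  exact (measure_mono fun x (hx : v n < ‖f x‖ₑ) => hsv.trans hx).trans hs

theorem rearr_antitone (f : ℝ → ℂ) : Antitone (rearr f) := fun _ _ h =>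
  sInf_le_sInf fun _ hs => le_trans hs (ENNReal.ofReal_le_ofReal h)

theorem measurable_rearr (f : ℝ → ℂ) : Measurable (rearr f) := (rearr_antitone f).measurable

theorem volume_lt_rearr (f : ℝ → ℂ) (σ : ℝ≥0∞) :
    volume.restrict (Set.Ioo (0 : ℝ) 1) {u | σ < rearr f u} = μ01 {x | σ < ‖f x‖ₑ} := by
  set D := μ01 {x | σ < ‖f x‖ₑ} with hD
  have hD1 : D ≤ 1 := prob_le_one
  have hDt : D ≠ ∞ := (hD1.trans_lt ENNReal.one_lt_top).ne
  rw [Measure.restrict_apply (measurableSet_lt measurable_const (measurable_rearr f))]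
  have : {u | σ < rearr f u} ∩ Set.Ioo (0 : ℝ) 1 = Set.Ioo 0 D.toReal := by
    ext u
    simp only [Set.mem_inter_iff, Set.mem_ofPred_eq, Set.mem_Ioo]
    rw [← not_le, rearr_le_iff, not_le, ← hD]
    have h1 : D.toReal ≤ 1 := ENNReal.toReal_le_of_le_ofReal zero_le_one (by simpa using hD1)
    constructor
    · rintro ⟨h, h0, -⟩
      exact ⟨h0, (ENNReal.ofReal_lt_iff_lt_toReal h0.le hDt).1 h⟩
    · rintro ⟨h0, h⟩
      exact ⟨(ENNReal.ofReal_lt_iff_lt_toReal h0.le hDt).2 h, h0, h.trans_le h1⟩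
  rw [this, Real.volume_Ioo, sub_zero, ENNReal.ofReal_toReal hDt]

/-- Equimeasurability: on `(0, 1)` each superlevel set of `f*` is an interval starting at `0`, of
the measure of the corresponding superlevel set of `|f|`. -/
theorem map_enorm_eq_map_rearr {f : ℝ → ℂ} (hf : AEStronglyMeasurable f μ01) :
    Measure.map (fun x => ‖f x‖ₑ) μ01 =
      Measure.map (rearr f) (volume.restrict (Set.Ioo (0 : ℝ) 1)) := by
  have hm1 : AEMeasurable (fun x => ‖f x‖ₑ) μ01 := hf.enorm
  have hm2 := (measurable_rearr f).aemeasurable (μ := volume.restrict (Set.Ioo (0 : ℝ) 1))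
  have := Measure.isProbabilityMeasure_map hm1
  have := Measure.isProbabilityMeasure_map hm2
  refine Measure.ext_of_Iic _ _ fun σ => ?_
  rw [← Set.compl_Ioi, prob_compl_eq_one_sub measurableSet_Ioi,
    prob_compl_eq_one_sub measurableSet_Ioi, Measure.map_apply_of_aemeasurable hm1 measurableSet_Ioi,
    Measure.map_apply_of_aemeasurable hm2 measurableSet_Ioi]
  congr 1
  exact (volume_lt_rearr f σ).symm

theorem lintegral_comp_rearr {f : ℝ → ℂ} (hf : AEStronglyMeasurable f μ01) {g : ℝ≥0∞ → ℝ≥0∞}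
    (hg : Measurable g) :
    ∫⁻ x, g ‖f x‖ₑ ∂μ01 = ∫⁻ u in Set.Ioo (0 : ℝ) 1, g (rearr f u) := by
  have hm1 : AEMeasurable (fun x => ‖f x‖ₑ) μ01 := hf.enorm
  rw [← lintegral_map' hg.aemeasurable hm1, map_enorm_eq_map_rearr hf,
    lintegral_map hg (measurable_rearr f)]

/-! ### Splitting at the height `f*(s)`. -/

/-- The `L_2` norm of the rearrangement over `(t, 1)`. -/
noncomputable def tail (f : ℝ → ℂ) (t : ℝ) : ℝ≥0∞ :=
  (∫⁻ u in Set.Ioo t 1, rearr f u ^ 2) ^ (1 / 2 : ℝ)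

/-- The `L_1` norm of the rearrangement over `(0, s)`. -/
noncomputable def head (f : ℝ → ℂ) (s : ℝ) : ℝ≥0∞ :=
  ∫⁻ u in Set.Ioo 0 s, rearr f u

theorem tail_antitone (f : ℝ → ℂ) : Antitone (tail f) := fun _ _ h =>
  ENNReal.rpow_le_rpow (lintegral_mono_set (Set.Ioo_subset_Ioo_left h)) (by norm_num)

theorem tail_sq (f : ℝ → ℂ) (t : ℝ) : tail f t ^ 2 = ∫⁻ u in Set.Ioo t 1, rearr f u ^ 2 := by
  rw [tail, ← ENNReal.rpow_natCast, ← ENNReal.rpow_mul]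
  norm_num

theorem lintegral_lt_rearr_le {f : ℝ → ℂ} (hf : AEStronglyMeasurable f μ01) {s : ℝ} :
    ∫⁻ x, (Set.Ioi (rearr f s)).indicator id ‖f x‖ₑ ∂μ01 ≤ head f s := by
  rw [lintegral_comp_rearr hf (measurable_id.indicator measurableSet_Ioi), head,
    ← lintegral_indicator measurableSet_Ioo, ← lintegral_indicator measurableSet_Ioo]
  refine lintegral_mono fun u => ?_
  by_cases hu : u ∈ Set.Ioo (0 : ℝ) 1
  · rw [Set.indicator_of_mem hu]
    by_cases h : rearr f s < rearr f u
    · have hus : u < s := (rearr_antitone f).reflect_lt h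
      rw [Set.indicator_of_mem (show rearr f u ∈ Set.Ioi (rearr f s) from h),
        Set.indicator_of_mem (show u ∈ Set.Ioo 0 s from ⟨hu.1, hus⟩)]
      rfl
    · rw [Set.indicator_of_notMem (show rearr f u ∉ Set.Ioi (rearr f s) from h)]
      exact zero_le
  · rw [Set.indicator_of_notMem hu]
    exact zero_le

theorem rearr_mul_le_head (f : ℝ → ℂ) (s : ℝ) : rearr f s * ENNReal.ofReal s ≤ head f s := by
  have := setLIntegral_mono' (μ := volume) (f := fun _ => rearr f s) (g := rearr f)
    (measurableSet_Ioo (a := (0 : ℝ)) (b := s)) fun u hu => rearr_antitone f hu.2.le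
  simpa [head] using this

/-- On `(0, s]` the truncated rearrangement is at most `f*(s)`, and `s f*(s)² = s⁻¹ (s f*(s))²` with
`s f*(s) ≤ head f s`. -/
theorem lintegral_le_rearr_sq_le {f : ℝ → ℂ} (hf : AEStronglyMeasurable f μ01) {s : ℝ}
    (hs : 0 < s) :
    ∫⁻ x, (Set.Iic (rearr f s)).indicator (fun y => y ^ 2) ‖f x‖ₑ ∂μ01 ≤
      (ENNReal.ofReal s)⁻¹ * head f s ^ 2 + tail f s ^ 2 := by
  have hs0 : ENNReal.ofReal s ≠ 0 := by simpa using hs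
  set lam := rearr f s
  have hsub : Set.Ioo (0 : ℝ) 1 ⊆ Set.Ioc 0 s ∪ Set.Ioo s 1 := fun u hu => by
    rcases le_or_gt u s with h | h
    · exact Or.inl ⟨hu.1, h⟩
    · exact Or.inr ⟨h, hu.2⟩
  have hg : Measurable ((Set.Iic lam).indicator fun y : ℝ≥0∞ => y ^ 2) :=
    (measurable_id.pow_const 2).indicator measurableSet_Iic
  rw [lintegral_comp_rearr hf hg]
  refine (lintegral_mono_set hsub).trans ((lintegral_union_le _ _ _).trans ?_)
  rw [tail_sq]
  refine add_le_add ?_ ?_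
  · calc ∫⁻ u in Set.Ioc 0 s, (Set.Iic lam).indicator (fun y => y ^ 2) (rearr f u)
        ≤ ∫⁻ _ in Set.Ioc 0 s, lam ^ 2 := by
          refine lintegral_mono fun u => ?_
          by_cases h : rearr f u ≤ lam
          · rw [Set.indicator_of_mem (show rearr f u ∈ Set.Iic lam from h)]
            dsimp only
            gcongr
          · rw [Set.indicator_of_notMem (show rearr f u ∉ Set.Iic lam from h)]
            exact zero_le
      _ = (ENNReal.ofReal s)⁻¹ * (lam * ENNReal.ofReal s) ^ 2 := by
          rw [setLIntegral_const, Real.volume_Ioc, sub_zero]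
          calc lam ^ 2 * ENNReal.ofReal s
              = ((ENNReal.ofReal s)⁻¹ * ENNReal.ofReal s) * (lam ^ 2 * ENNReal.ofReal s) := by
                rw [ENNReal.inv_mul_cancel hs0 ENNReal.ofReal_ne_top, one_mul]
            _ = _ := by ring
      _ ≤ _ := by
          gcongr
          exact rearr_mul_le_head f s
  · exact lintegral_mono fun u => Set.indicator_le_self' (fun _ _ => zero_le) _

/-! ### Dyadic control of the head by tails. -/

/-- The base `2 ^ (-1/8)` of the geometric weights in the dyadic decomposition. -/
noncomputable def ratio : ℝ≥0 := 2 ^ (-(1 / 8) : ℝ)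

theorem ratio_pos : 0 < ratio := NNReal.rpow_pos (by norm_num)

theorem ratio_lt_one : ratio < 1 := NNReal.rpow_lt_one_of_one_lt_of_neg (by norm_num) (by norm_num)

theorem ratio_pow_eight : ratio ^ 8 = 1 / 2 := by
  rw [ratio, ← NNReal.rpow_natCast, ← NNReal.rpow_mul]
  norm_num [NNReal.rpow_neg]

/-- The dyadic maximal quantity controlling `tail` and `head`. -/
noncomputable def dyadicSup (f : ℝ → ℂ) (s : ℝ) : ℝ≥0∞ :=
  ⨆ j : ℕ, (ratio : ℝ≥0∞) ^ (2 * j) * tail f (s / 2 ^ j)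

theorem tail_le_dyadicSup (f : ℝ → ℂ) (s : ℝ) : tail f s ≤ dyadicSup f s := by
  refine le_trans ?_ (le_iSup _ 0)
  simp

theorem lintegral_rearr_Ioo_le (f : ℝ → ℂ) {b c : ℝ} (hb : b ≤ 1) :
    ∫⁻ u in Set.Ioo c b, rearr f u ≤ tail f c * ENNReal.ofReal (b - c) ^ (1 / 2 : ℝ) := by
  have h := ENNReal.lintegral_mul_le_Lp_mul_Lq (volume.restrict (Set.Ioo c b))
    Real.HolderConjugate.two_two (measurable_rearr f).aemeasurable
    (aemeasurable_const (b := (1 : ℝ≥0∞)))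
  simp only [Pi.mul_apply, mul_one, lintegral_const,
    Measure.restrict_apply_univ, Real.volume_Ioo, ENNReal.rpow_two, one_pow, one_mul] at h
  refine h.trans ?_
  gcongr
  exact ENNReal.rpow_le_rpow (lintegral_mono_set (Set.Ioo_subset_Ioo_right hb)) (by norm_num)

theorem Ioo_subset_iUnion_dyadic (s : ℝ) :
    Set.Ioo 0 s ⊆ ⋃ j : ℕ, Set.Ioc (s / 2 ^ (j + 1)) (s / 2 ^ j) := by
  intro u hu
  have hs : 0 < s := hu.1.trans hu.2
  obtain ⟨n, hn1, hn2⟩ := exists_nat_pow_near_of_lt_one (x := u / s) (y := (1 / 2 : ℝ))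
    (div_pos hu.1 hs) ((div_le_one hs).2 hu.2.le) (by norm_num) (by norm_num)
  refine Set.mem_iUnion.2 ⟨n, ?_, ?_⟩
  · rw [lt_div_iff₀ hs] at hn1
    rw [div_eq_mul_one_div, ← one_div_pow]; linarith
  · rw [div_le_iff₀ hs] at hn2
    rw [div_eq_mul_one_div, ← one_div_pow]; linarith

theorem ofReal_dyadic_rpow (s : ℝ) (j : ℕ) :
    ENNReal.ofReal (s / 2 ^ j) ^ (1 / 2 : ℝ) =
      ENNReal.ofReal s ^ (1 / 2 : ℝ) * (ratio : ℝ≥0∞) ^ (4 * j) := by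
  have h1 : ENNReal.ofReal (s / 2 ^ j) = ENNReal.ofReal s * ((ratio : ℝ≥0∞) ^ (4 * j)) ^ 2 := by
    have h2 : ((ratio : ℝ≥0∞) ^ (4 * j)) ^ 2 = ENNReal.ofReal ((1 / 2) ^ j) := by
      rw [← pow_mul, show 4 * j * 2 = 8 * j by ring, pow_mul, ← ENNReal.coe_pow, ratio_pow_eight,
        ENNReal.ofReal_pow (by norm_num)]
      congr 1
      rw [ENNReal.ofReal, ENNReal.coe_inj]
      ext
      simp
    rw [h2, ← ENNReal.ofReal_mul' (by positivity), one_div_pow, ← div_eq_mul_one_div]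
  rw [h1, ENNReal.mul_rpow_of_nonneg _ _ (by norm_num)]
  congr 1
  rw [← ENNReal.rpow_natCast _ 2, ← ENNReal.rpow_mul]
  norm_num

theorem head_le_dyadicSup (f : ℝ → ℂ) {s : ℝ} (hs : 0 < s) (hs1 : s ≤ 1) :
    head f s ≤ (1 - (ratio : ℝ≥0∞) ^ 2)⁻¹ * (ENNReal.ofReal s ^ (1 / 2 : ℝ) * dyadicSup f s) := by
  have hterm : ∀ j : ℕ, ∫⁻ u in Set.Ioc (s / 2 ^ (j + 1)) (s / 2 ^ j), rearr f u ≤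
      ((ratio : ℝ≥0∞) ^ 2) ^ j * (ENNReal.ofReal s ^ (1 / 2 : ℝ) * dyadicSup f s) := by
    intro j
    rw [setLIntegral_congr Ioo_ae_eq_Ioc.symm]
    have hb : s / 2 ^ j ≤ 1 := (div_le_one (by positivity)).2
      (hs1.trans (one_le_pow₀ (by norm_num)))
    refine (lintegral_rearr_Ioo_le f hb).trans ?_
    have hlen : s / 2 ^ j - s / 2 ^ (j + 1) = s / 2 ^ (j + 1) := by field_simp; ring
    have hle : (ratio : ℝ≥0∞) ^ (2 * (j + 1)) * tail f (s / 2 ^ (j + 1)) ≤ dyadicSup f s :=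
      le_iSup (fun j : ℕ => (ratio : ℝ≥0∞) ^ (2 * j) * tail f (s / 2 ^ j)) (j + 1)
    have hr1 : (ratio : ℝ≥0∞) ^ 2 ≤ 1 := pow_le_one₀ zero_le (by exact_mod_cast ratio_lt_one.le)
    rw [hlen, ofReal_dyadic_rpow]
    -- The exponent `4(j+1)` splits as `2(j+1) + 2j + 2`: the first part supplies the weight in
    -- `dyadicSup`, the second the geometric series, and the last is discarded.
    calc tail f (s / 2 ^ (j + 1)) * (ENNReal.ofReal s ^ (1 / 2 : ℝ) * (ratio : ℝ≥0∞) ^ (4 * (j + 1)))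
        = (ratio : ℝ≥0∞) ^ 2 * (((ratio : ℝ≥0∞) ^ 2) ^ j * (ENNReal.ofReal s ^ (1 / 2 : ℝ) *
          ((ratio : ℝ≥0∞) ^ (2 * (j + 1)) * tail f (s / 2 ^ (j + 1))))) := by ring
      _ ≤ 1 * (((ratio : ℝ≥0∞) ^ 2) ^ j * (ENNReal.ofReal s ^ (1 / 2 : ℝ) * dyadicSup f s)) := by
          gcongr
      _ = _ := one_mul _
  calc head f s ≤ ∑' j : ℕ, ∫⁻ u in Set.Ioc (s / 2 ^ (j + 1)) (s / 2 ^ j), rearr f u :=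
        (lintegral_mono_set (Ioo_subset_iUnion_dyadic s)).trans (lintegral_iUnion_le _ _)
    _ ≤ ∑' j : ℕ, ((ratio : ℝ≥0∞) ^ 2) ^ j * (ENNReal.ofReal s ^ (1 / 2 : ℝ) * dyadicSup f s) :=
        ENNReal.tsum_le_tsum hterm
    _ = _ := by rw [ENNReal.tsum_mul_right, ENNReal.tsum_geometric]

/-! ### The non-increasing rearrangement of a family -/

/-- Greedy choice: more than `k` indices exceed half of a nonzero `seqRearr a k`, so one of them is
still unused. Halving gives the strict inequality needed here and, squared, the factor `4`. -/
theorem exists_finset_sum_seqRearr_le {ι : Type} (a : ι → ℂ) (ha : ∀ i, seqRearr a i ≠ ∞) (k : ℕ) :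
    ∃ T : Finset ι, T.card ≤ k ∧
      ∑ i ∈ Finset.range k, seqRearr a i ^ 2 ≤ 4 * ∑ n ∈ T, ‖a n‖ₑ ^ 2 := by
  classical
  induction k with
  | zero => exact ⟨∅, by simp, by simp⟩
  | succ k ih =>
    obtain ⟨T, hT, hsum⟩ := ih
    rw [Finset.sum_range_succ]
    rcases eq_or_ne (seqRearr a k) 0 with h0 | h0
    · exact ⟨T, by omega, by simpa [h0] using hsum⟩
    have hlt : seqRearr a k / 2 < seqRearr a k := ENNReal.half_lt_self h0 (ha k)
    have hcard : (k : ℕ∞) < Set.encard {n | seqRearr a k / 2 < ‖a n‖ₑ} := by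
      by_contra! h
      exact absurd (show seqRearr a k ≤ seqRearr a k / 2 from sInf_le h) (not_le.2 hlt)
    obtain ⟨n, hn, hnT⟩ : ∃ n ∈ {n | seqRearr a k / 2 < ‖a n‖ₑ}, n ∉ (T : Set ι) := by
      by_contra! h
      have h1 := (Set.encard_le_encard (t := (T : Set ι)) h).trans_lt' hcard
      rw [Set.encard_coe_eq_coe_finsetCard] at h1
      exact absurd (by exact_mod_cast h1 : k < T.card) (by omega)
    refine ⟨insert n T, (Finset.card_insert_le _ _).trans (by omega), ?_⟩
    rw [Finset.sum_insert (by simpa using hnT), mul_add, add_comm]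
    refine add_le_add ?_ hsum
    calc seqRearr a k ^ 2 = 4 * (seqRearr a k / 2) ^ 2 := by
          rw [show (4 : ℝ≥0∞) = 2 ^ 2 by norm_num, ← mul_pow,
            ENNReal.mul_div_cancel (by norm_num) (by norm_num)]
      _ ≤ _ := by gcongr; exact hn.le

theorem seqRearr_le_of_forall_le {ι : Type} {a : ι → ℂ} {B : ℝ≥0∞} (h : ∀ n, ‖a n‖ₑ ≤ B) (k : ℕ) :
    seqRearr a k ≤ B := by
  refine sInf_le ?_
  have : {n | B < ‖a n‖ₑ} = ∅ := Set.eq_empty_of_forall_notMem fun n hn => not_lt.2 (h n) hn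
  simp [this]

theorem sum_seqRearr_sq_le {ι : Type} {a : ι → ℂ} {A : ℝ≥0∞} (hA : A ≠ ∞)
    (h : ∀ T : Finset ι, ∑ n ∈ T, ‖a n‖ₑ ^ 2 ≤ A) (k : ℕ) :
    ∑ i ∈ Finset.range k, seqRearr a i ^ 2 ≤ 4 * A := by
  have hb : ∀ n, ‖a n‖ₑ ≤ A ^ (1 / 2 : ℝ) := fun n => by
    have h1 : ‖a n‖ₑ ^ 2 ≤ A := by simpa using h {n}
    rwa [one_div, ENNReal.le_rpow_inv_iff (by norm_num), ENNReal.rpow_two]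
  have hfin : ∀ i, seqRearr a i ≠ ∞ := fun i =>
    ((seqRearr_le_of_forall_le hb i).trans_lt
      (ENNReal.rpow_lt_top_of_nonneg (by norm_num) hA)).ne
  obtain ⟨T, -, hT⟩ := exists_finset_sum_seqRearr_le a hfin k
  exact hT.trans (by gcongr; exact h T)

/-- If `|a n + b n| > s + B` then `|a n| > s`. -/
theorem seqRearr_add_le {ι : Type} {a b : ι → ℂ} {B : ℝ≥0∞} (hb : ∀ n, ‖b n‖ₑ ≤ B) (k : ℕ) :
    seqRearr (fun n => a n + b n) k ≤ seqRearr a k + B := by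
  rw [seqRearr, seqRearr, ENNReal.sInf_add]
  refine le_iInf₂ fun s hs => sInf_le ?_
  refine le_trans (Set.encard_le_encard fun n hn => ?_) hs
  by_contra! h
  simp only [Set.mem_ofPred_eq, not_lt] at h hn
  exact absurd ((enorm_add_le _ _).trans (add_le_add h (hb n))) (not_le.2 hn)

theorem sum_seqRearr_add_sq_le {ι : Type} {a b : ι → ℂ} {A B : ℝ≥0∞} (hA : A ≠ ∞)
    (h : ∀ T : Finset ι, ∑ n ∈ T, ‖a n‖ₑ ^ 2 ≤ A) (hb : ∀ n, ‖b n‖ₑ ≤ B) (k : ℕ) :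
    ∑ i ∈ Finset.range k, seqRearr (fun n => a n + b n) i ^ 2 ≤ 8 * A + 2 * (k * B ^ 2) := by
  calc ∑ i ∈ Finset.range k, seqRearr (fun n => a n + b n) i ^ 2
      ≤ ∑ i ∈ Finset.range k, (2 * seqRearr a i ^ 2 + 2 * B ^ 2) := by
        refine Finset.sum_le_sum fun i _ => ?_
        refine (pow_le_pow_left₀ zero_le (seqRearr_add_le hb i) 2).trans ?_
        rw [← mul_add]
        have := ENNReal.rpow_add_le_mul_rpow_add_rpow (seqRearr a i) B (p := 2) (by norm_num)
        norm_num at this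
        exact this
    _ = 2 * ∑ i ∈ Finset.range k, seqRearr a i ^ 2 + 2 * (k * B ^ 2) := by
        rw [Finset.sum_add_distrib, ← Finset.mul_sum, Finset.sum_const, Finset.card_range,
          nsmul_eq_mul]
        ring
    _ ≤ 2 * (4 * A) + 2 * (k * B ^ 2) := by
        gcongr
        exact sum_seqRearr_sq_le hA h k
    _ = _ := by ring

/-! ### Fourier coefficients with respect to a bounded orthonormal system -/

section System

variable {ι : Type} {φ : ι → Lp ℂ 2 μ01} {M : ℝ≥0}

theorem enorm_le_of_iSup_eLpNorm_eq (hM : (⨆ n, eLpNorm (φ n) ∞ μ01) = (M : ℝ≥0∞)) (n : ι) :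
    ∀ᵐ x ∂μ01, ‖φ n x‖ₑ ≤ M := by
  have h : eLpNormEssSup (φ n) μ01 ≤ M := by
    rw [← hM, ← eLpNorm_exponent_top]
    exact le_iSup (fun n => eLpNorm (φ n) ∞ μ01) n
  filter_upwards [enorm_ae_le_eLpNormEssSup (φ n) μ01] with x hx using hx.trans h

/-- On a probability space `1 = ‖φ_n‖_2 ≤ ‖φ_n‖_∞`. This gives `log M ≥ 0` and keeps `s = 1/(M² k)`
in `(0, 1]`. -/
theorem one_le_of_orthonormal [Nonempty ι] (hφ : Orthonormal ℂ φ)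
    (hM : (⨆ n, eLpNorm (φ n) ∞ μ01) = (M : ℝ≥0∞)) : 1 ≤ M := by
  obtain ⟨n⟩ := ‹Nonempty ι›
  have h1 : eLpNorm (φ n) 2 μ01 = 1 := by
    rw [← Lp.enorm_def, ← ofReal_norm, hφ.1 n, ENNReal.ofReal_one]
  have h2 : (1 : ℝ≥0∞) ≤ M := by
    rw [← h1, ← hM]
    exact (eLpNorm_le_eLpNorm_of_exponent_le le_top (Lp.aestronglyMeasurable _)).trans
      (le_iSup (fun n => eLpNorm (φ n) ∞ μ01) n)
  exact_mod_cast h2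

theorem aestronglyMeasurable_mul_conj {f : ℝ → ℂ} (hf : AEStronglyMeasurable f μ01) (n : ι) :
    AEStronglyMeasurable (fun x => f x * conj (φ n x)) μ01 :=
  hf.mul (Complex.continuous_conj.comp_aestronglyMeasurable (Lp.aestronglyMeasurable (φ n)))

theorem lintegral_enorm_mul_conj_le (hM : (⨆ n, eLpNorm (φ n) ∞ μ01) = (M : ℝ≥0∞)) (f : ℝ → ℂ)
    (n : ι) : ∫⁻ x, ‖f x * conj (φ n x)‖ₑ ∂μ01 ≤ M * ∫⁻ x, ‖f x‖ₑ ∂μ01 := by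
  rw [← lintegral_const_mul' _ _ ENNReal.coe_ne_top]
  refine lintegral_mono_ae ?_
  filter_upwards [enorm_le_of_iSup_eLpNorm_eq hM n] with x hx
  rw [enorm_mul, RCLike.enorm_conj, mul_comm]
  gcongr

theorem integrable_mul_conj (hM : (⨆ n, eLpNorm (φ n) ∞ μ01) = (M : ℝ≥0∞)) {f : ℝ → ℂ}
    (hf : Integrable f μ01) (n : ι) : Integrable (fun x => f x * conj (φ n x)) μ01 :=
  ⟨aestronglyMeasurable_mul_conj hf.1 n, (lintegral_enorm_mul_conj_le hM f n).trans_lt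
    (ENNReal.mul_lt_top ENNReal.coe_lt_top hf.2)⟩

theorem enorm_fourierCoeffs_le (hM : (⨆ n, eLpNorm (φ n) ∞ μ01) = (M : ℝ≥0∞)) (f : ℝ → ℂ)
    (n : ι) : ‖fourierCoeffs φ f n‖ₑ ≤ M * ∫⁻ x, ‖f x‖ₑ ∂μ01 :=
  (enorm_integral_le_lintegral_enorm _).trans (lintegral_enorm_mul_conj_le hM f n)

theorem sum_enorm_fourierCoeffs_sq_le (hφ : Orthonormal ℂ φ) {f : ℝ → ℂ} (hf : MemLp f 2 μ01)
    (T : Finset ι) : ∑ n ∈ T, ‖fourierCoeffs φ f n‖ₑ ^ 2 ≤ ∫⁻ x, ‖f x‖ₑ ^ 2 ∂μ01 := by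
  have hc : ∀ n, fourierCoeffs φ f n = inner ℂ (φ n) (hf.toLp f) := fun n => by
    rw [L2.inner_def, fourierCoeffs]
    refine integral_congr_ae ?_
    filter_upwards [hf.coeFn_toLp] with x hx
    rw [hx, RCLike.inner_apply]
  have hnorm : ∫⁻ x, ‖f x‖ₑ ^ 2 ∂μ01 = ENNReal.ofReal (‖hf.toLp f‖ ^ 2) := by
    rw [ENNReal.ofReal_pow (norm_nonneg _), ofReal_norm, Lp.enorm_toLp,
      eLpNorm_eq_lintegral_rpow_enorm_toReal (by norm_num) (by norm_num), ← ENNReal.rpow_natCast,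
      ← ENNReal.rpow_mul]
    norm_num
  have h := hφ.sum_inner_products_le (hf.toLp f) (s := T)
  rw [hnorm]
  refine le_trans (le_of_eq ?_) (ENNReal.ofReal_le_ofReal h)
  rw [ENNReal.ofReal_sum_of_nonneg fun _ _ => by positivity]
  refine Finset.sum_congr rfl fun n _ => ?_
  rw [hc, ENNReal.ofReal_pow (norm_nonneg _), ofReal_norm]

theorem lintegral_enorm_eq_head {f : ℝ → ℂ} (hf : AEStronglyMeasurable f μ01) :
    ∫⁻ x, ‖f x‖ₑ ∂μ01 = head f 1 :=
  lintegral_comp_rearr hf measurable_id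

/-- The low part `g` is handled by Bessel's inequality, the high part `h` by the uniform bound on
the system. -/
theorem sum_seqRearr_fourierCoeffs_sq_le (hφ : Orthonormal ℂ φ)
    (hM : (⨆ n, eLpNorm (φ n) ∞ μ01) = (M : ℝ≥0∞)) {f : ℝ → ℂ} (hf : Integrable f μ01) {s : ℝ}
    (hs : 0 < s) (hhead : head f s ≠ ∞) (htail : tail f s ≠ ∞) (k : ℕ) :
    ∑ i ∈ Finset.range k, seqRearr (fourierCoeffs φ f) i ^ 2 ≤
      8 * ((ENNReal.ofReal s)⁻¹ * head f s ^ 2 + tail f s ^ 2) +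
        2 * (k * (M * head f s) ^ 2) := by
  set E := {x | ‖f x‖ₑ ≤ rearr f s} with hE
  have hmeas : NullMeasurableSet E μ01 := hf.1.enorm.nullMeasurable measurableSet_Iic
  set g := E.indicator f with hg
  set h := Eᶜ.indicator f with hh
  have hgh : ∀ x, f x = g x + h x := fun x => by
    rw [hg, hh, Set.indicator_self_add_compl_apply]
  have hgi : Integrable g μ01 := hf.indicator₀ hmeas
  have hhi : Integrable h μ01 := hf.indicator₀ hmeas.compl
  have hg2 : ∫⁻ x, ‖g x‖ₑ ^ 2 ∂μ01 ≤ (ENNReal.ofReal s)⁻¹ * head f s ^ 2 + tail f s ^ 2 := by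
    refine le_trans (lintegral_mono fun x => ?_) (lintegral_le_rearr_sq_le hf.1 hs)
    by_cases hx : ‖f x‖ₑ ≤ rearr f s
    · rw [hg, Set.indicator_of_mem (show x ∈ E from hx),
        Set.indicator_of_mem (show ‖f x‖ₑ ∈ Set.Iic (rearr f s) from hx)]
    · rw [hg, Set.indicator_of_notMem (show x ∉ E from hx)]
      simp
  have hh1 : ∫⁻ x, ‖h x‖ₑ ∂μ01 ≤ head f s := by
    refine le_trans (lintegral_mono fun x => ?_) (lintegral_lt_rearr_le hf.1)
    by_cases hx : ‖f x‖ₑ ≤ rearr f s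
    · rw [hh, Set.indicator_of_notMem (show x ∉ Eᶜ from fun h' => h' hx)]
      simp
    · rw [hh, Set.indicator_of_mem (show x ∈ Eᶜ from hx),
        Set.indicator_of_mem (show ‖f x‖ₑ ∈ Set.Ioi (rearr f s) from not_le.1 hx)]
      rfl
  have hfin : (ENNReal.ofReal s)⁻¹ * head f s ^ 2 + tail f s ^ 2 ≠ ∞ :=
    ENNReal.add_ne_top.2 ⟨ENNReal.mul_ne_top (by simpa using hs) (ENNReal.pow_ne_top hhead),
      ENNReal.pow_ne_top htail⟩
  have hgL : MemLp g 2 μ01 := by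
    refine ⟨hgi.1, ?_⟩
    rw [eLpNorm_eq_lintegral_rpow_enorm_toReal (by norm_num) (by norm_num)]
    refine ENNReal.rpow_lt_top_of_nonneg (by norm_num) (ne_top_of_le_ne_top hfin ?_)
    simpa using hg2
  have hsum : fourierCoeffs φ f = fun n => fourierCoeffs φ g n + fourierCoeffs φ h n := by
    funext n
    simp only [fourierCoeffs]
    rw [← integral_add (integrable_mul_conj hM hgi n) (integrable_mul_conj hM hhi n)]
    refine integral_congr_ae (Filter.Eventually.of_forall fun x => ?_)
    dsimp only
    rw [hgh x, add_mul]
  rw [hsum]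
  refine sum_seqRearr_add_sq_le hfin
    (fun T => (sum_enorm_fourierCoeffs_sq_le hφ hgL T).trans hg2) (fun n => ?_) k
  refine (enorm_fourierCoeffs_le hM h n).trans ?_
  gcongr

end System

/-! ### Choice of `s` and passage to the quasi-norms. -/

/-- The constant in the pointwise bound of the partial sums. -/
noncomputable def partialSumConst : ℝ≥0∞ :=
  (10 * ((1 - (ratio : ℝ≥0∞) ^ 2)⁻¹) ^ 2 + 8) ^ (1 / 2 : ℝ)

theorem inv_one_sub_ratio_sq_ne_top : (1 - (ratio : ℝ≥0∞) ^ 2)⁻¹ ≠ ∞ := by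
  refine ENNReal.inv_ne_top.2 (tsub_pos_of_lt ?_).ne'
  exact pow_lt_one₀ zero_le (by exact_mod_cast ratio_lt_one) (by norm_num)

theorem partialSumConst_ne_top : partialSumConst ≠ ∞ :=
  ENNReal.rpow_ne_top_of_nonneg (by norm_num) (ENNReal.add_ne_top.2
    ⟨ENNReal.mul_ne_top (by norm_num) (ENNReal.pow_ne_top inv_one_sub_ratio_sq_ne_top),
      by norm_num⟩)

theorem inv_mul_head_sq_le (f : ℝ → ℂ) {s : ℝ} (hs : 0 < s) (hs1 : s ≤ 1) :
    (ENNReal.ofReal s)⁻¹ * head f s ^ 2 ≤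
      ((1 - (ratio : ℝ≥0∞) ^ 2)⁻¹) ^ 2 * dyadicSup f s ^ 2 := by
  have hs0 : ENNReal.ofReal s ≠ 0 := by simpa using hs
  have hsq : (ENNReal.ofReal s ^ (1 / 2 : ℝ)) ^ 2 = ENNReal.ofReal s := by
    rw [← ENNReal.rpow_natCast, ← ENNReal.rpow_mul]
    norm_num
  calc (ENNReal.ofReal s)⁻¹ * head f s ^ 2
      ≤ (ENNReal.ofReal s)⁻¹ * ((1 - (ratio : ℝ≥0∞) ^ 2)⁻¹ *
          (ENNReal.ofReal s ^ (1 / 2 : ℝ) * dyadicSup f s)) ^ 2 := by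
        gcongr
        exact head_le_dyadicSup f hs hs1
    _ = (ENNReal.ofReal s)⁻¹ * ENNReal.ofReal s *
          (((1 - (ratio : ℝ≥0∞) ^ 2)⁻¹) ^ 2 * dyadicSup f s ^ 2) := by
        rw [mul_pow, mul_pow, hsq]; ring
    _ = _ := by rw [ENNReal.inv_mul_cancel hs0 ENNReal.ofReal_ne_top, one_mul]

theorem partialSum_fourierCoeffs_le {ι : Type} {φ : ι → Lp ℂ 2 μ01} {M : ℝ≥0}
    (hφ : Orthonormal ℂ φ) (hM : (⨆ n, eLpNorm (φ n) ∞ μ01) = (M : ℝ≥0∞)) (hM1 : 1 ≤ M)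
    {f : ℝ → ℂ} (hf : Integrable f μ01) (htail : ∀ t, 0 < t → t ≤ 1 → tail f t ≠ ∞) (k : ℕ) :
    (∑ i ∈ Finset.range (k + 1), seqRearr (fourierCoeffs φ f) i ^ 2) ^ (1 / 2 : ℝ) ≤
      partialSumConst * dyadicSup f (1 / (M : ℝ) ^ 2 / ((k : ℝ) + 1)) := by
  set s := 1 / (M : ℝ) ^ 2 / ((k : ℝ) + 1) with hs
  have hM1' : (1 : ℝ) ≤ M := by exact_mod_cast hM1
  have hs0 : 0 < s := by positivity
  have hs1 : s ≤ 1 := by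
    rw [hs, div_div, div_le_one (by positivity)]
    nlinarith [one_le_pow₀ hM1' (n := 2), k.cast_nonneg (α := ℝ)]
  have hhead : head f s ≠ ∞ := by
    refine ne_top_of_le_ne_top ?_ (lintegral_mono_set (Set.Ioo_subset_Ioo_right hs1))
    have := hf.2
    rw [HasFiniteIntegral, lintegral_enorm_eq_head hf.1] at this
    exact this.ne
  have hkey := sum_seqRearr_fourierCoeffs_sq_le hφ hM hf hs0 hhead (htail s hs0 hs1) (k + 1)
  -- The choice of `s` gives `(k + 1) M² = 1/s`, so the high part contributes the same head term as
  -- the low part; hence `10 = 8 + 2` below.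
  have hsinv : ((k + 1 : ℕ) : ℝ≥0∞) * (M * head f s) ^ 2 =
      (ENNReal.ofReal s)⁻¹ * head f s ^ 2 := by
    have : (ENNReal.ofReal s)⁻¹ = ((k + 1 : ℕ) : ℝ≥0∞) * (M : ℝ≥0∞) ^ 2 := by
      rw [← ENNReal.ofReal_inv_of_pos hs0, hs, div_div, one_div, inv_inv,
        ENNReal.ofReal_mul (by positivity), ENNReal.ofReal_pow (by positivity),
        ENNReal.ofReal_coe_nnreal, mul_comm]
      congr 1
      exact_mod_cast ENNReal.ofReal_natCast (k + 1)
    rw [this]; ring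
  rw [hsinv] at hkey
  have hhead2 := inv_mul_head_sq_le f hs0 hs1
  have htail2 := tail_le_dyadicSup f s
  have hfinal : ∑ i ∈ Finset.range (k + 1), seqRearr (fourierCoeffs φ f) i ^ 2 ≤
      (10 * ((1 - (ratio : ℝ≥0∞) ^ 2)⁻¹) ^ 2 + 8) * dyadicSup f s ^ 2 := by
    refine hkey.trans ?_
    calc _ ≤ 8 * (((1 - (ratio : ℝ≥0∞) ^ 2)⁻¹) ^ 2 * dyadicSup f s ^ 2 + dyadicSup f s ^ 2) +
          2 * (((1 - (ratio : ℝ≥0∞) ^ 2)⁻¹) ^ 2 * dyadicSup f s ^ 2) := by gcongr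
      _ = _ := by ring
  refine (ENNReal.rpow_le_rpow hfinal (by norm_num)).trans ?_
  rw [ENNReal.mul_rpow_of_nonneg _ _ (by norm_num), ← ENNReal.rpow_natCast (dyadicSup f s),
    ← ENNReal.rpow_mul, partialSumConst]
  norm_num

/-- The term `k = 0` of the sampled sequence, whose weight is `1`, is bounded by the whole
quasi-norm. -/
theorem tail_le_normLR {q : ℝ≥0∞} (hq : 0 < q) {α a : ℝ} (hα : α ≤ 0) (f : ℝ → ℂ) (ha : 0 < a)
    (ha1 : a ≤ 1) :
    tail f a ≤ ENNReal.ofReal (2 ^ (q⁻¹).toReal * (1 + Real.log (2 / a)) ^ (-α)) *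
      normLR q α f := by
  have h := enorm_le_eLpNorm_count (fun k : ℕ => seqWeight q α k * tail f (a / ((k : ℝ) + 1))) 0
    hq.ne'
  have h0 : seqWeight q α 0 = 1 := by simp [seqWeight]
  simp only [h0, enorm_eq_self, one_mul, Nat.cast_zero, zero_add, div_one] at h
  exact h.trans (eLpNorm_seqWeight_le hq (tail_antitone f) hα ha ha1)

/-- The bound of the dyadic pieces, uniform in the sup-norm bound `M`. -/
theorem exists_ratio_pow_mul_le {q : ℝ≥0∞} {α : ℝ} (hα : α ≤ 0) :
    ∃ C : ℝ≥0, ∀ (j : ℕ) (M : ℝ), 1 ≤ M →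
      (ratio : ℝ≥0∞) ^ (2 * j) * ENNReal.ofReal
        (2 ^ (q⁻¹).toReal * (1 + Real.log (2 / (1 / M ^ 2 / 2 ^ j))) ^ (-α)) ≤
          (ratio : ℝ≥0∞) ^ j * (C * ENNReal.ofReal ((1 + Real.log M) ^ (-α))) := by
  obtain ⟨C, hC, h⟩ := exists_log_rpow_mul_pow_le (β := -α) (r := ratio) (by linarith)
    (by exact_mod_cast ratio_pos) (by exact_mod_cast ratio_lt_one)
  refine ⟨(2 ^ (q⁻¹).toReal * C).toNNReal, fun j M hM => ?_⟩
  have hr : (ratio : ℝ≥0∞) ^ j = ENNReal.ofReal ((ratio : ℝ) ^ j) := by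
    rw [ENNReal.ofReal_pow ratio.coe_nonneg, ENNReal.ofReal_coe_nnreal]
  -- One factor `ratio ^ j` absorbs the growth of the logarithm in `j`; the other is kept for the
  -- supremum over `j`.
  rw [two_mul, pow_add, mul_assoc]
  refine mul_le_mul_right ?_ _
  rw [hr, ← ENNReal.ofReal_mul (by positivity), ← ENNReal.ofReal,
    ← ENNReal.ofReal_mul (by positivity)]
  apply ENNReal.ofReal_le_ofReal
  have := mul_le_mul_of_nonneg_left (h j M hM) (show (0 : ℝ) ≤ 2 ^ (q⁻¹).toReal by positivity)
  linarith

/-- The `L_1` norm is `head f 1`, and the tails at `2^(-j)` grow at most like a power of `j + 2`, so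
`dyadicSup f 1` is finite. -/
theorem MemLR.integrable {q : ℝ≥0∞} (hq : 0 < q) {α : ℝ} (hα : α ≤ 0) {f : ℝ → ℂ}
    (hf : MemLR q α f) : Integrable f μ01 := by
  refine ⟨hf.1, ?_⟩
  rw [HasFiniteIntegral, lintegral_enorm_eq_head hf.1]
  refine (head_le_dyadicSup f one_pos le_rfl).trans_lt ?_
  rw [ENNReal.ofReal_one, ENNReal.one_rpow, one_mul]
  refine ENNReal.mul_lt_top inv_one_sub_ratio_sq_ne_top.lt_top ?_
  obtain ⟨C, hC⟩ := exists_ratio_pow_mul_le (q := q) hα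
  have hbound : dyadicSup f 1 ≤ C * normLR q α f := by
    refine iSup_le fun j => ?_
    have h1 := hC j 1 le_rfl
    have h2 := tail_le_normLR hq hα f (a := 1 / 2 ^ j) (by positivity)
      ((div_le_one (by positivity)).2 (one_le_pow₀ (by norm_num)))
    rw [Real.log_one, add_zero, Real.one_rpow, ENNReal.ofReal_one, mul_one, one_pow, div_one] at h1
    calc (ratio : ℝ≥0∞) ^ (2 * j) * tail f (1 / 2 ^ j)
        ≤ (ratio : ℝ≥0∞) ^ (2 * j) * (ENNReal.ofReal (2 ^ (q⁻¹).toReal *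
            (1 + Real.log (2 / (1 / 2 ^ j))) ^ (-α)) * normLR q α f) := by gcongr
      _ ≤ (ratio : ℝ≥0∞) ^ j * C * normLR q α f := by rw [← mul_assoc]; gcongr
      _ ≤ 1 * C * normLR q α f := by
          gcongr
          exact pow_le_one₀ zero_le (by exact_mod_cast ratio_lt_one.le)
      _ = _ := by rw [one_mul]
  exact hbound.trans_lt (ENNReal.mul_lt_top ENNReal.coe_lt_top hf.2)

theorem exists_eLpNorm_dyadicSup_le {q : ℝ≥0∞} (hq : 0 < q) {α : ℝ} (hα : α ≤ 0) :
    ∃ C : ℝ≥0, ∀ (f : ℝ → ℂ) (M : ℝ), 1 ≤ M →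
      eLpNorm (fun k : ℕ => seqWeight q α k * dyadicSup f (1 / M ^ 2 / ((k : ℝ) + 1))) q
        Measure.count ≤ C * (ENNReal.ofReal ((1 + Real.log M) ^ (-α)) * normLR q α f) := by
  obtain ⟨C₁, hC₁⟩ := eLpNorm_iSup_le_of_geometric (μ := (Measure.count : Measure ℕ))
    (r := ratio) hq (by exact_mod_cast ratio_lt_one)
  obtain ⟨C₂, hC₂⟩ := exists_ratio_pow_mul_le (q := q) hα
  refine ⟨C₁ * C₂, fun f M hM => ?_⟩
  have hM0 : 0 < M := by linarith
  set g : ℕ → ℕ → ℝ≥0∞ := fun j k =>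
    (ratio : ℝ≥0∞) ^ (2 * j) * (seqWeight q α k * tail f (1 / M ^ 2 / 2 ^ j / ((k : ℝ) + 1)))
    with hg
  have hsup : (fun k : ℕ => seqWeight q α k * dyadicSup f (1 / M ^ 2 / ((k : ℝ) + 1))) =
      fun k => ⨆ j, g j k := by
    funext k
    rw [dyadicSup, ENNReal.mul_iSup]
    refine iSup_congr fun j => ?_
    rw [hg, div_right_comm]
    ring
  rw [hsup, ENNReal.coe_mul, mul_assoc, ← mul_assoc (C₂ : ℝ≥0∞)]
  refine hC₁ g _ (fun j => measurable_from_nat) fun j => ?_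
  have hY := eLpNorm_seqWeight_le hq (a := 1 / M ^ 2 / 2 ^ j) (tail_antitone f) hα
    (by positivity) (by
    rw [div_div, div_le_one (by positivity)]
    exact one_le_mul_of_one_le_of_one_le (one_le_pow₀ hM) (one_le_pow₀ (by norm_num)))
  have hpull : eLpNorm (g j) q Measure.count ≤ (ratio : ℝ≥0∞) ^ (2 * j) *
      eLpNorm (fun k : ℕ => seqWeight q α k * tail f (1 / M ^ 2 / 2 ^ j / ((k : ℝ) + 1))) q
        Measure.count := by
    have := eLpNorm_le_nnreal_smul_eLpNorm_of_ae_le_mul' (f := g j)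
      (g := fun k : ℕ => seqWeight q α k * tail f (1 / M ^ 2 / 2 ^ j / ((k : ℝ) + 1)))
      (μ := Measure.count) (c := ratio ^ (2 * j))
      (Filter.Eventually.of_forall fun k => by simp [hg]) q
    simpa [ENNReal.smul_def] using this
  calc eLpNorm (g j) q Measure.count
      ≤ (ratio : ℝ≥0∞) ^ (2 * j) * (ENNReal.ofReal (2 ^ (q⁻¹).toReal *
          (1 + Real.log (2 / (1 / M ^ 2 / 2 ^ j))) ^ (-α)) * normLR q α f) := by
        refine hpull.trans ?_
        gcongr
        exact hY
    _ ≤ (ratio : ℝ≥0∞) ^ j * (C₂ * ENNReal.ofReal ((1 + Real.log M) ^ (-α))) * normLR q α f := by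
        rw [← mul_assoc]
        exact mul_le_mul_left (hC₂ j M hM) _
    _ = _ := by rw [mul_assoc]

end LimitingFourier

theorem theorem1p1 (q : ℝ≥0∞) (hq : 0 < q) (α : ℝ) (hα : α < -(q⁻¹).toReal) :
    ∃ C : ℝ≥0, 0 < C ∧
      ∀ (ι : Type) [Nonempty ι] (φ : ι → Lp ℂ 2 LimitingFourier.μ01) (M : ℝ≥0),
        Orthonormal ℂ φ →
        (⨆ n, eLpNorm (φ n) ∞ LimitingFourier.μ01) = (M : ℝ≥0∞) →
        ∀ f : ℝ → ℂ, LimitingFourier.MemLR q α f →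
          Integrable f LimitingFourier.μ01 ∧
          LimitingFourier.normlL q α (LimitingFourier.fourierCoeffs φ f) ≤
            (C : ℝ≥0∞) *
              ENNReal.ofReal (min (M : ℝ) ((1 + Real.log (M : ℝ)) ^ |α|)) *
              LimitingFourier.normLR q α f := by
  open LimitingFourier in
  have hα0 : α < 0 := hα.trans_le (neg_nonpos.2 ENNReal.toReal_nonneg)
  obtain ⟨C₁, hC₁⟩ := exists_eLpNorm_dyadicSup_le hq hα0.le
  set K := partialSumConst.toNNReal with hK
  have hKe : (K : ℝ≥0∞) = partialSumConst := ENNReal.coe_toNNReal partialSumConst_ne_top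
  set C₂ := ((1 + |α|) ^ |α|).toNNReal with hC₂
  -- The summand `1` only ensures positivity, since `C₁` may vanish.
  refine ⟨K * C₁ * C₂ + 1, by positivity, fun ι _ φ M hφ hM f hf => ?_⟩
  have hint : Integrable f μ01 := hf.integrable hq hα0.le
  refine ⟨hint, ?_⟩
  have hM1 : 1 ≤ M := one_le_of_orthonormal hφ hM
  have hM1' : (1 : ℝ) ≤ M := by exact_mod_cast hM1
  have htail : ∀ t, 0 < t → t ≤ 1 → tail f t ≠ ∞ := fun t ht ht1 =>
    ((tail_le_normLR hq hα0.le f ht ht1).trans_lt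
      (ENNReal.mul_lt_top ENNReal.ofReal_lt_top hf.2)).ne
  have hlog : ENNReal.ofReal ((1 + Real.log M) ^ (-α)) ≤
      C₂ * ENNReal.ofReal (min (M : ℝ) ((1 + Real.log (M : ℝ)) ^ |α|)) := by
    rw [hC₂, ← ENNReal.ofReal, ← ENNReal.ofReal_mul (by positivity), ← abs_of_neg hα0]
    exact ENNReal.ofReal_le_ofReal (one_add_log_rpow_le_mul_min (abs_pos.2 hα0.ne) hM1')
  have hstep : normlL q α (fourierCoeffs φ f) ≤ K *
      eLpNorm (fun k : ℕ => seqWeight q α k * dyadicSup f (1 / (M : ℝ) ^ 2 / ((k : ℝ) + 1))) q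
        Measure.count := by
    have := eLpNorm_le_nnreal_smul_eLpNorm_of_ae_le_mul'
      (f := fun k : ℕ => seqWeight q α k *
        (∑ i ∈ Finset.range (k + 1), seqRearr (fourierCoeffs φ f) i ^ 2) ^ (1 / 2 : ℝ))
      (g := fun k : ℕ => seqWeight q α k * dyadicSup f (1 / (M : ℝ) ^ 2 / ((k : ℝ) + 1)))
      (μ := Measure.count) (c := K)
      (Filter.Eventually.of_forall fun k => by
        simp only [enorm_eq_self]
        rw [hKe, mul_left_comm]
        gcongr
        exact partialSum_fourierCoeffs_le hφ hM hM1 hint htail k) q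
    rwa [ENNReal.smul_def, smul_eq_mul] at this
  calc normlL q α (fourierCoeffs φ f)
      ≤ K * (C₁ * (C₂ * ENNReal.ofReal (min (M : ℝ) ((1 + Real.log (M : ℝ)) ^ |α|)) *
          normLR q α f)) := by
        refine hstep.trans ?_
        gcongr
        refine (hC₁ f M hM1').trans ?_
        gcongr
    _ = ((K * C₁ * C₂ : ℝ≥0) : ℝ≥0∞) *
          ENNReal.ofReal (min (M : ℝ) ((1 + Real.log (M : ℝ)) ^ |α|)) * normLR q α f := by
        push_cast; ring
    _ ≤ _ := by
        gcongr
        exact le_self_add
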